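/- Let $\Sigma$ be a finite alphabet. All automata are finite, complete and transition-labelled; a co-Büchi automaton uses only the colors $1$ (rejecting) and $2$ (accepting), and a run is accepting if the lowest color occurring infinitely often is even. $L(\mathcal A,q)$ is the language of $\mathcal A$ started in $q$, and $L^{acc}(q)$ is the set of words having a run from $q$ that visits only accepting transitions. A co-Büchi automaton $\mathcal A$ is good-for-games if some strategy $f:\Sigma^*\to Q$, seeing only the prefix read so far, produces a run on every word, and an accepting run on every word of $L(\mathcal A)$. It is the *canonical* good-for-games co-Büchi automaton of its language (Abu Radi and Kupferman) if it is good-for-games and * it is nice: all states are reachable and good-for-games; whenever $p$ is reachable from $q$ by accepting transitions, $q$ is reachable from $p$ by accepting transitions; each state has at most one accepting transition on each letter; and all successors of a state on a letter have the same language; * it has the least number of states among the good-for-games co-Büchi automata for its language; * no state has both accepting and rejecting transitions on the same letter $x$, and a state $q$ without accepting transition on $x$ has a rejecting transition on $x$ to every state whose language equals that of a successor of $q$ on $x$. A *COCOA* is a finite sequence $\mathcal A^1,\dots,\mathcal A^n$ of canonical good-for-games co-Büchi automata $\mathcal A^l=(\Sigma,Q^l,q_0^l,\delta^l)$ with $L(\mathcal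 A^1)\supseteq\dots\supseteq L(\mathcal A^n)$; write $\delta^l(q,x)$ for the set of successors of $q$ on $x$. The *natural color* of $w\in\Sigma^\omega$ is the largest $l$ with $w\in L(\mathcal A^l)$, or $0$ if there is none. The COCOA accepts $w$ iff its natural color is even. *Restrictions.* For all $l$, $q\in Q^l$, $x\in\Sigma$ and $r^j\in Q^j$ ($j<l$), let $g^l(q,x,r^1,\dots,r^{l-1})=S\subseteq\delta^l(q,x)$ be any set such that, with $L^{acc}(r^1,\dots,r^{l-1},s)=L^{acc}(s)\cap\bigcap_{j<l}L^{acc}(r^j)$, no two distinct $s,t\in S$ satisfy $L^{acc}(r^1,\dots,r^{l-1},t)\subseteq L^{acc}(r^1,\dots,r^{l-1},s)$, and for every $t\in\delta^l(q,x)$ there is $s\in S$ with $L^{acc}(r^1,\dots,r^{l-1},t)\subseteq L^{acc}(r^1,\dots,r^{l-1},s)$. *Optimized product.* A simple alternating parity automaton has a transition function $\delta:Q\times\Sigma\to 2^Q\times\mathbb N\times\{\mathsf{rej},\mathsf{acc}\}$. In the word-checking game on $w=x_0x_1\dots$, started in the initial state, in state $q_i$ with $\delta(q_i,x_i)=(T,c_i,pl_i)$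 the player $pl_i$ picks $q_{i+1}\in T$; the acceptor wins iff the lowest color occurring infinitely often in $c_0c_1\dots$ is even. The word $w$ is accepted iff the acceptor has a strategy (possibly depending on $w$) that wins every play. The *optimized COCOA product* is the following simple alternating parity automaton. Its initial state is $(q_0^1,\dots,q_0^n)$. Its state set $Q_O$ consists of the tuples in $Q^1\times\dots\times Q^n$ reachable from the initial state by steps from $(q^l)_l$ to $(\tilde q^l)_l$ such that, for some letter $x$, $\tilde q^l\in g^l(q^l,x,\tilde q^1,\dots,\tilde q^{l-1})$ for all $l$. For $q\in Q_O$ and $x\in\Sigma$ let $r$ be the smallest level such that $\mathcal A^r$ has a rejecting transition from $q^r$ on $x$, or $r=n+1$ if there is none. Then $\delta(q,x)=(T,r-1,pl)$, where $pl=\mathsf{rej}$ for odd $r$ and $pl=\mathsf{acc}$ for even $r$, and $$T=\{\tilde q\in Q_O : \tilde q^l\in\delta^l(q^l,x)\text{ for all } l<r,\text{ and for all } l\ge r\text{ there is } s\in\delta^l(q^l,x)\text{ with } L(\mathcal A^l,\tilde q^l)=L(\mathcal A^l,s)\}.$$ **Claim.** For every COCOA and every choice of the restrictions $g^1,\dots,g^n$,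 the optimized COCOA product is good-for-games: the acceptor has a strategy $f_{acc}:(Q_O\times\Sigma)^*\to Q_O$ that wins the word-checking game on every accepted word, and the rejector has a strategy $f_{rej}:(Q_O\times\Sigma)^*\to Q_O$ that wins it on every word that is not accepted, where both strategies see only the states visited and the letters read so far. Moreover, the optimized product accepts exactly the words accepted by the COCOA, that is, those whose natural color is even. -/

import Mathlib

namespace Cocoa

/-! ### Infinite words, min-even acceptance -/

/-- The prefix `u 0, …, u (i - 1)` of length `i` of an infinite sequence. -/
def pref {β : Type*} (u : ℕ → β) (i : ℕ) : List β := (List.range i).map u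

/-- The lowest color occurring infinitely often in the color sequence `c` is even. -/
def MinEven (c : ℕ → ℕ) : Prop :=
  ∃ k, Even k ∧ (∃ᶠ i in Filter.atTop, c i = k) ∧ ∀ j < k, ¬ ∃ᶠ i in Filter.atTop, c i = j

/-! ### Parity and co-Büchi automata with transition-based acceptance -/

/-- Complete nondeterministic parity automata over the alphabet `α` with state set `Q`.
`trans q x q' c` says that there is a transition from `q` on `x` to `q'` of color `c`. -/
structure ParityAutomaton (α : Type*) (Q : Type*) where
  init : Q
  trans : Q → α → Q → ℕ → Prop
  color_unique : ∀ q x q' c c', trans q x q' c → trans q x q' c' → c = c'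
  complete : ∀ q x, ∃ q' c, trans q x q' c

namespace ParityAutomaton

variable {α : Type*} {Q : Type*}

/-- The set of successors of `q` on `x`. -/
def succ (A : ParityAutomaton α Q) (q : Q) (x : α) : Set Q :=
  {q' | ∃ c, A.trans q x q' c}

/-- `π` is a run on `w` of the automaton started in `q`. -/
def IsRunFrom (A : ParityAutomaton α Q) (q : Q) (w : ℕ → α) (π : ℕ → Q) : Prop :=
  π 0 = q ∧ ∀ i, π (i + 1) ∈ A.succ (π i) (w i)

/-- `π` is an accepting run on `w` of the automaton started in `q`. -/
def IsAcceptingRunFrom (A : ParityAutomaton α Q) (q : Q) (w : ℕ → α) (π : ℕ → Q) : Prop :=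
  π 0 = q ∧ ∃ c : ℕ → ℕ, (∀ i, A.trans (π i) (w i) (π (i + 1)) (c i)) ∧ MinEven c

/-- The language of the automaton started in `q`. -/
def languageFrom (A : ParityAutomaton α Q) (q : Q) : Set (ℕ → α) :=
  {w | ∃ π, A.IsAcceptingRunFrom q w π}

/-- The language of the automaton. -/
def language (A : ParityAutomaton α Q) : Set (ℕ → α) := A.languageFrom A.init

/-- The automaton started in `q` is good-for-games: some strategy that sees only the prefix read
so far yields a run on every word, and an accepting one on every word of the language. -/
def IsGFGFrom (A : ParityAutomaton α Q) (q : Q) : Prop :=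
  ∃ f : List α → Q, ∀ w : ℕ → α,
    A.IsRunFrom q w (fun i => f (pref w i)) ∧
      (w ∈ A.languageFrom q → A.IsAcceptingRunFrom q w (fun i => f (pref w i)))

/-- The automaton is good-for-games. -/
def IsGFG (A : ParityAutomaton α Q) : Prop := A.IsGFGFrom A.init

/-- Only colors `1` (rejecting) and `2` (accepting) occur. -/
def IsCoBuchi (A : ParityAutomaton α Q) : Prop :=
  ∀ q x q' c, A.trans q x q' c → c = 1 ∨ c = 2

/-- `L^acc(q)`: the words with a run from `q` visiting only accepting transitions of the
co-Büchi automaton. -/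
def accLanguage (A : ParityAutomaton α Q) (q : Q) : Set (ℕ → α) :=
  {w | ∃ π : ℕ → Q, π 0 = q ∧ ∀ i, A.trans (π i) (w i) (π (i + 1)) 2}

/-- `q` is reachable from `p`. -/
def Reach (A : ParityAutomaton α Q) : Q → Q → Prop :=
  Relation.ReflTransGen fun p q => ∃ x, q ∈ A.succ p x

/-- `q` is reachable from `p` by accepting transitions of the co-Büchi automaton. -/
def AccReach (A : ParityAutomaton α Q) : Q → Q → Prop :=
  Relation.ReflTransGen fun p q => ∃ x, A.trans p x q 2

/-- Nice co-Büchi automata in the sense of Abu Radi and Kupferman: all states are reachable and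
good-for-games, and the automaton is normal (accepting transitions do not connect different
components of the accepting part), deterministic in its accepting part, and
semantically deterministic. -/
structure IsNice (A : ParityAutomaton α Q) : Prop where
  reachable : ∀ q, A.Reach A.init q
  gfg : ∀ q, A.IsGFGFrom q
  normal : ∀ p q, A.AccReach p q → A.AccReach q p
  acc_det : ∀ q x s s', A.trans q x s 2 → A.trans q x s' 2 → s = s'
  sem_det : ∀ q x, ∀ s ∈ A.succ q x, ∀ s' ∈ A.succ q x, A.languageFrom s = A.languageFrom s'

/-- No good-for-games co-Büchi automaton for the same language has fewer states. -/
def IsMinimal (A : ParityAutomaton α Q) : Prop :=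
  ∀ (m : ℕ) (B : ParityAutomaton α (Fin m)),
    B.IsCoBuchi → B.IsGFG → B.language = A.language → Nat.card Q ≤ m

/-- Maximal up to homogeneity in the sense of Abu Radi and Kupferman: no state has both
accepting and rejecting transitions on the same letter, and where it has no accepting transition,
it has rejecting transitions to all states equivalent to one of its successors. -/
structure IsMaximalUpToHomogeneity (A : ParityAutomaton α Q) : Prop where
  homogeneous : ∀ q x s s', ¬ (A.trans q x s 2 ∧ A.trans q x s' 1)
  maximal : ∀ q x, (¬ ∃ s, A.trans q x s 2) →
    ∀ s ∈ A.succ q x, ∀ s', A.languageFrom s' = A.languageFrom s → A.trans q x s' 1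

/-- The canonical good-for-games co-Büchi automata of Abu Radi and Kupferman: the nice, minimal
ones that are maximal up to homogeneity. -/
structure IsCanonical (A : ParityAutomaton α Q) : Prop where
  coBuchi : A.IsCoBuchi
  gfg : A.IsGFG
  nice : A.IsNice
  minimal : A.IsMinimal
  maximal : A.IsMaximalUpToHomogeneity

end ParityAutomaton

/-! ### Simple alternating parity automata -/

/-- The two players of the word-checking game. -/
inductive Player
  | rej
  | acc

/-- Simple alternating parity automata: `next q x` is the set of successors, the color shared by
the transitions, and the player who picks the successor. -/
structure SimpleAlternating (α : Type*) (Q : Type*) where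
  init : Q
  next : Q → α → Set Q × ℕ × Player

namespace SimpleAlternating

variable {α : Type*} {Q : Type*}

/-- The possible next states. -/
def targets (B : SimpleAlternating α Q) (q : Q) (x : α) : Set Q := (B.next q x).1

/-- The color of the transitions. -/
def color (B : SimpleAlternating α Q) (q : Q) (x : α) : ℕ := (B.next q x).2.1

/-- The player in control. -/
def owner (B : SimpleAlternating α Q) (q : Q) (x : α) : Player := (B.next q x).2.2

/-- `π` is the sequence of states of a play of the word-checking game on `w`. -/
def IsPlay (B : SimpleAlternating α Q) (w : ℕ → α) (π : ℕ → Q) : Prop :=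
  π 0 = B.init ∧ ∀ i, π (i + 1) ∈ B.targets (π i) (w i)

/-- The acceptor wins the play `π` on `w`; otherwise the rejector wins it. -/
def AcceptorWinsPlay (B : SimpleAlternating α Q) (w : ℕ → α) (π : ℕ → Q) : Prop :=
  MinEven fun i => B.color (π i) (w i)

/-- `w` is accepted: in the word-checking game on `w` the acceptor has a strategy `f` (which may
depend on `w`, and maps the states seen so far to a permitted next state) that wins every play
consistent with it. -/
def Accepts (B : SimpleAlternating α Q) (w : ℕ → α) : Prop :=
  ∃ f : List Q → Q,
    (∀ h q, B.owner q (w h.length) = Player.acc →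
      f (h ++ [q]) ∈ B.targets q (w h.length)) ∧
    ∀ π, B.IsPlay w π →
      (∀ i, B.owner (π i) (w i) = Player.acc → π (i + 1) = f (pref π (i + 1))) →
      B.AcceptorWinsPlay w π

/-- The set of accepted words. -/
def language (B : SimpleAlternating α Q) : Set (ℕ → α) := {w | B.Accepts w}

/-- `f`, which sees only the states visited and the letters read so far, is a strategy of player
`P`: it picks permitted successors wherever `P` is in control. -/
def IsStrategy (B : SimpleAlternating α Q) (P : Player) (f : List (Q × α) → Q) : Prop :=
  ∀ h q x, B.owner q x = P → f (h ++ [(q, x)]) ∈ B.targets q x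

/-- The play `π` on `w` is consistent with the strategy `f` of player `P`. -/
def IsConsistent (B : SimpleAlternating α Q) (P : Player) (f : List (Q × α) → Q)
    (w : ℕ → α) (π : ℕ → Q) : Prop :=
  ∀ i, B.owner (π i) (w i) = P → π (i + 1) = f (pref (fun j => (π j, w j)) (i + 1))

/-- A-GFG: the acceptor has a prefix-based strategy winning the word-checking game on every
accepted word, and the rejector has one winning it on every rejected word. -/
def IsGFG (B : SimpleAlternating α Q) : Prop :=
  (∃ f, B.IsStrategy Player.acc f ∧ ∀ w, B.Accepts w → ∀ π, B.IsPlay w π →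
      B.IsConsistent Player.acc f w π → B.AcceptorWinsPlay w π) ∧
  (∃ f, B.IsStrategy Player.rej f ∧ ∀ w, ¬ B.Accepts w → ∀ π, B.IsPlay w π →
      B.IsConsistent Player.rej f w π → ¬ B.AcceptorWinsPlay w π)

end SimpleAlternating

/-! ### Chains of co-Büchi automata; level `l + 1` of the chain is `A l` for `l : Fin n` -/

variable {α : Type*} {n : ℕ} {Q : Fin n → Type*}

/-- A chain of canonical good-for-games co-Büchi automata with falling languages. -/
structure IsCOCOA (A : ∀ l, ParityAutomaton α (Q l)) : Prop where
  canonical : ∀ l, (A l).IsCanonical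
  falling : ∀ l l', l < l' → (A l').language ⊆ (A l).language

/-- The natural color: the largest level whose automaton accepts `w`, or `0` if there is none
(the supremum of the empty set of natural numbers is `0`). -/
noncomputable def naturalColor (A : ∀ l, ParityAutomaton α (Q l)) (w : ℕ → α) : ℕ :=
  sSup {k | ∃ l : Fin n, k = l.val + 1 ∧ w ∈ (A l).language}

/-- The language of the chain. -/
def chainLanguage (A : ∀ l, ParityAutomaton α (Q l)) : Set (ℕ → α) :=
  {w | Even (naturalColor A w)}

/-- `L^acc` of the states `r` on the levels below `l` together with the state `s` on level `l`. -/
def jointAcc (A : ∀ l, ParityAutomaton α (Q l)) (l : Fin n) (r : ∀ j, j < l → Q j) (s : Q l) :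
    Set (ℕ → α) :=
  {w | (∀ j (hj : j < l), w ∈ (A j).accLanguage (r j hj)) ∧ w ∈ (A l).accLanguage s}

/-- `g` is a choice of restriction functions: given the state `q` on level `l`, the letter `x` and
the successor states `r` on the lower levels, `g l q x r` is a set of successors of `q` on `x` that
are pairwise incomparable with respect to `L^acc` (joint with `r`) and among which each successor
is dominated; so it holds one representative for each maximal value of `L^acc`. -/
structure IsRestriction (A : ∀ l, ParityAutomaton α (Q l))
    (g : ∀ l : Fin n, Q l → α → (∀ j, j < l → Q j) → Set (Q l)) : Prop where
  subset : ∀ l q x r, g l q x r ⊆ (A l).succ q x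
  incomparable : ∀ l q x r, ∀ s ∈ g l q x r,
    ¬ ∃ t ∈ g l q x r, t ≠ s ∧ jointAcc A l r t ⊆ jointAcc A l r s
  dominating : ∀ l q x r, ∀ t ∈ (A l).succ q x,
    ∃ s ∈ g l q x r, jointAcc A l r t ⊆ jointAcc A l r s

/-- The smallest level `r` whose automaton has a rejecting transition on `x`, or `n + 1`. -/
noncomputable def rejLevel (A : ∀ l, ParityAutomaton α (Q l)) (q : ∀ l, Q l) (x : α) : ℕ :=
  sInf ({k | ∃ l : Fin n, k = l.val + 1 ∧ ∃ q', (A l).trans (q l) x q' 1} ∪ {n + 1})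

/-- The player in control when `r` is the smallest rejecting level. -/
def levelOwner (r : ℕ) : Player := if r % 2 = 1 then Player.rej else Player.acc

/-- The joint successors that respect the restriction functions. -/
def restrictedSucc (g : ∀ l : Fin n, Q l → α → (∀ j, j < l → Q j) → Set (Q l))
    (q : ∀ l, Q l) (x : α) : Set (∀ l, Q l) :=
  {q' | ∀ l, q' l ∈ g l (q l) x (fun j _ => q' j)}

/-- The tuple of initial states. -/
def initTuple (A : ∀ l, ParityAutomaton α (Q l)) : ∀ l, Q l := fun l => (A l).init

/-- The tuples reachable from the initial one by restricted joint successors. -/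
def reducedStates (A : ∀ l, ParityAutomaton α (Q l))
    (g : ∀ l : Fin n, Q l → α → (∀ j, j < l → Q j) → Set (Q l)) : Set (∀ l, Q l) :=
  {q | Relation.ReflTransGen (fun p p' => ∃ x, p' ∈ restrictedSucc g p x) (initTuple A) q}

/-- The reduced product. -/
noncomputable def reducedProduct (A : ∀ l, ParityAutomaton α (Q l))
    (g : ∀ l : Fin n, Q l → α → (∀ j, j < l → Q j) → Set (Q l)) :
    SimpleAlternating α (reducedStates A g) where
  init := ⟨initTuple A, Relation.ReflTransGen.refl⟩
  next q x :=
    ({q' | q'.1 ∈ restrictedSucc g q.1 x}, rejLevel A q.1 x - 1, levelOwner (rejLevel A q.1 x))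

/-- The optimized product: same states, initial state, colors and owners as the reduced product;
levels below the smallest rejecting level `r` move to their successor, the levels from `r` on
may jump to every state equivalent to a successor, as long as the tuple is a state. -/
noncomputable def optimizedProduct (A : ∀ l, ParityAutomaton α (Q l))
    (g : ∀ l : Fin n, Q l → α → (∀ j, j < l → Q j) → Set (Q l)) :
    SimpleAlternating α (reducedStates A g) where
  init := (reducedProduct A g).init
  next q x :=
    ({q' | (∀ l : Fin n, l.val + 1 < rejLevel A q.1 x → q'.1 l ∈ (A l).succ (q.1 l) x) ∧
        (∀ l : Fin n, rejLevel A q.1 x ≤ l.val + 1 →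
          ∃ s ∈ (A l).succ (q.1 l) x, (A l).languageFrom (q'.1 l) = (A l).languageFrom s)},
      ((reducedProduct A g).next q x).2)

end Cocoa

/-! Both players use one strategy `f`, built from the good-for-games strategies `F l` of the single
levels. Given the history, `f` moves to a restricted successor that, on each level where the choice
of `F l` is a successor, has an accepting language at least as large, jointly with the lower levels.

Fix a play on `w` and let `m` be the least rejecting level seen infinitely often. Colors are shifted
by one, so the acceptor wins iff `m` is odd; the owner of level `m` is exactly the player who then
loses. In every play `m` is at most the natural color plus one: otherwise the first level that
should reject `w` eventually only accepts, and since jumps preserve residual languages, that level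
accepts `w` (`le_naturalColor_add_one`).

If moreover the owner of level `m` follows `f`, then level `m` rejects `w`
(`notMem_language_of_isConsistent`). Otherwise the run of `F` on that level eventually only accepts.
At a late rejection the owner can jump to a state dominating the one chosen by `F`; lower levels no
longer reject, so the remaining word lies in the joint accepting language, and by determinism of
accepting transitions level `m` never rejects again.

Hence a player following `f` either wins, because the opponent owns `m`, or forces `m` to be the
natural color plus one, whose parity gives the right winner. -/

namespace Cocoa

/-- The suffix of an infinite word that starts at position `i`. -/
def suffix {β : Type*} (w : ℕ → β) (i : ℕ) : ℕ → β := fun k => w (i + k)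

theorem pref_succ {β : Type*} (u : ℕ → β) (i : ℕ) : pref u (i + 1) = pref u i ++ [u i] := by
  simp [pref, List.range_succ]

theorem length_pref {β : Type*} (u : ℕ → β) (i : ℕ) : (pref u i).length = i := by
  simp [pref]

theorem map_pref {β γ : Type*} (f : β → γ) (u : ℕ → β) (i : ℕ) :
    (pref u i).map f = pref (fun j => f (u j)) i := by
  simp [pref]

theorem frequently_add_one {p : ℕ → Prop} :
    (∃ᶠ i in Filter.atTop, p (i + 1)) ↔ ∃ᶠ i in Filter.atTop, p i := by
  have h : (∀ᶠ i in Filter.atTop, ¬ p (i + 1)) ↔ ∀ᶠ i in Filter.atTop, ¬ p i := by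
    rw [← Filter.eventually_map (f := Filter.atTop) (m := fun i : ℕ => i + 1) (P := fun i => ¬ p i),
      Filter.map_add_atTop_eq_nat]
  exact not_congr h

theorem minEven_add_one {c : ℕ → ℕ} : MinEven (fun i => c (i + 1)) ↔ MinEven c := by
  unfold MinEven
  have h (k : ℕ) : (∃ᶠ i in Filter.atTop, c (i + 1) = k) ↔ ∃ᶠ i in Filter.atTop, c i = k :=
    frequently_add_one (p := fun i => c i = k)
  simp only [h]

/-! ### Residual languages and accepting tails in co-Büchi automata -/

namespace ParityAutomaton

variable {α Q : Type*} {A : ParityAutomaton α Q}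

theorem succ_nonempty (A : ParityAutomaton α Q) (q : Q) (x : α) : (A.succ q x).Nonempty := by
  obtain ⟨q', c, h⟩ := A.complete q x
  exact ⟨q', c, h⟩

theorem mem_languageFrom_iff_exists_succ {q : Q} {w : ℕ → α} :
    w ∈ A.languageFrom q ↔ ∃ s ∈ A.succ q (w 0), (fun i => w (i + 1)) ∈ A.languageFrom s := by
  constructor
  · rintro ⟨π, rfl, c, hc, hm⟩
    exact ⟨π 1, ⟨c 0, hc 0⟩, fun i => π (i + 1), rfl, fun i => c (i + 1), fun i => hc (i + 1),
      minEven_add_one.2 hm⟩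
  · rintro ⟨s, ⟨d, hd⟩, π, rfl, c, hc, hm⟩
    refine ⟨fun i => Nat.casesOn i q π, rfl, fun i => Nat.casesOn i d c, ?_, ?_⟩
    · rintro (_ | i)
      · exact hd
      · exact hc i
    · exact minEven_add_one.1 hm

theorem IsNice.mem_languageFrom_iff (hA : A.IsNice) {q s : Q} {w : ℕ → α}
    (hs : s ∈ A.succ q (w 0)) :
    w ∈ A.languageFrom q ↔ (fun i => w (i + 1)) ∈ A.languageFrom s := by
  rw [mem_languageFrom_iff_exists_succ]
  refine ⟨?_, fun h => ⟨s, hs, h⟩⟩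
  rintro ⟨s', hs', h⟩
  rwa [hA.sem_det q _ s hs s' hs']

/-- By semantic determinism, a successor on `x` recognizes the left quotient by `x` of the state's
language, which depends on that language only. -/
theorem IsNice.languageFrom_succ_congr (hA : A.IsNice) {p q s t : Q} {x : α}
    (hpq : A.languageFrom p = A.languageFrom q) (hs : s ∈ A.succ p x) (ht : t ∈ A.succ q x) :
    A.languageFrom s = A.languageFrom t := by
  ext w
  have h₁ := hA.mem_languageFrom_iff (w := fun i => Nat.casesOn i x w) hs
  have h₂ := hA.mem_languageFrom_iff (w := fun i => Nat.casesOn i x w) ht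
  rw [hpq] at h₁
  exact h₁.symm.trans h₂

/-- `ρ` starts in the initial state, and each step leads to a state that is equivalent to a
successor. -/
def IsQuasiRun (A : ParityAutomaton α Q) (w : ℕ → α) (ρ : ℕ → Q) : Prop :=
  ρ 0 = A.init ∧ ∀ i, ∃ s ∈ A.succ (ρ i) (w i), A.languageFrom (ρ (i + 1)) = A.languageFrom s

theorem IsRunFrom.isQuasiRun {w : ℕ → α} {ρ : ℕ → Q} (h : A.IsRunFrom A.init w ρ) :
    A.IsQuasiRun w ρ :=
  ⟨h.1, fun i => ⟨ρ (i + 1), h.2 i, rfl⟩⟩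

theorem IsQuasiRun.languageFrom_eq (hA : A.IsNice) {w : ℕ → α} {ρ ρ' : ℕ → Q}
    (h : A.IsQuasiRun w ρ) (h' : A.IsQuasiRun w ρ') (i : ℕ) :
    A.languageFrom (ρ i) = A.languageFrom (ρ' i) := by
  induction i with
  | zero => rw [h.1, h'.1]
  | succ i ih =>
    obtain ⟨s, hs, es⟩ := h.2 i
    obtain ⟨t, ht, et⟩ := h'.2 i
    rw [es, et, hA.languageFrom_succ_congr ih hs ht]

/-- Language-preserving jumps do not alter the residual, so membership of `w` can be tested at any
later time. -/
theorem IsQuasiRun.suffix_mem_iff (hA : A.IsNice) {w : ℕ → α} {ρ : ℕ → Q}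
    (h : A.IsQuasiRun w ρ) (i : ℕ) :
    suffix w i ∈ A.languageFrom (ρ i) ↔ w ∈ A.language := by
  induction i with
  | zero =>
    have : suffix w 0 = w := by funext k; simp [suffix]
    rw [h.1, this, language]
  | succ i ih =>
    obtain ⟨s, hs, es⟩ := h.2 i
    have e : suffix w (i + 1) = fun k => suffix w i (k + 1) := by
      funext k; simp only [suffix]; congr 1; omega
    rw [← ih, es, e]
    exact (hA.mem_languageFrom_iff (w := suffix w i) hs).symm

theorem accLanguage_subset_languageFrom (q : Q) : A.accLanguage q ⊆ A.languageFrom q := by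
  rintro w ⟨π, h0, h⟩
  refine ⟨π, h0, fun _ => 2, h, 2, even_two, ?_, ?_⟩
  · exact Filter.Eventually.frequently (Filter.Eventually.of_forall fun _ => rfl)
  · intro j hj
    simp [hj.ne']

theorem suffix_mem_accLanguage {w : ℕ → α} {ρ : ℕ → Q} {N : ℕ}
    (h : ∀ i ≥ N, A.trans (ρ i) (w i) (ρ (i + 1)) 2) {i : ℕ} (hi : N ≤ i) :
    suffix w i ∈ A.accLanguage (ρ i) :=
  ⟨fun k => ρ (i + k), rfl, fun k => h (i + k) (hi.trans (Nat.le_add_right _ _))⟩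

theorem exists_trans_of_suffix_mem_accLanguage {w : ℕ → α} {q : Q} {i : ℕ}
    (h : suffix w i ∈ A.accLanguage q) :
    ∃ s, A.trans q (w i) s 2 ∧ suffix w (i + 1) ∈ A.accLanguage s := by
  obtain ⟨π, rfl, h⟩ := h
  refine ⟨π 1, h 0, fun k => π (k + 1), rfl, fun k => ?_⟩
  have e : suffix w (i + 1) k = suffix w i (k + 1) := by
    simp only [suffix]; congr 1; omega
  rw [e]
  exact h (k + 1)

theorem IsCoBuchi.eventually_accepting (hA : A.IsCoBuchi) {w : ℕ → α} {q : Q} {ρ : ℕ → Q}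
    (h : A.IsAcceptingRunFrom q w ρ) :
    ∀ᶠ i in Filter.atTop, A.trans (ρ i) (w i) (ρ (i + 1)) 2 := by
  obtain ⟨-, c, hc, k, hk, hf, hlt⟩ := h
  -- The least recurring color is even and only 1 and 2 occur, so it is 2 and color 1 occurs
  -- finitely often.
  have hk2 : k = 2 := by
    obtain ⟨i, hi⟩ := hf.exists
    rcases hA _ _ _ _ (hc i) with h | h
    · rw [← hi, h] at hk
      exact absurd hk (by decide)
    · exact hi.symm.trans h
  have h1 := hlt 1 (by omega)
  rw [Filter.not_frequently] at h1
  filter_upwards [h1] with i hi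
  have := (hA _ _ _ _ (hc i)).resolve_left hi
  rw [← this]
  exact hc i

theorem IsCoBuchi.trans_two_of_mem_succ (hA : A.IsCoBuchi) {q s : Q} {x : α}
    (hs : s ∈ A.succ q x) (h : ¬ ∃ q', A.trans q x q' 1) : A.trans q x s 2 := by
  obtain ⟨c, hc⟩ := hs
  rcases hA _ _ _ _ hc with rfl | rfl
  · exact absurd ⟨s, hc⟩ h
  · exact hc

end ParityAutomaton

/-! ### Rejecting levels and dominating strategies -/

variable {α : Type*} {n : ℕ} {Q : Fin n → Type*} {A : ∀ l, ParityAutomaton α (Q l)}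
  {g : ∀ l : Fin n, Q l → α → (∀ j, j < l → Q j) → Set (Q l)}

theorem rejLevel_mem (A : ∀ l, ParityAutomaton α (Q l)) (q : ∀ l, Q l) (x : α) :
    rejLevel A q x ∈ ({k | ∃ l : Fin n, k = l.val + 1 ∧ ∃ q', (A l).trans (q l) x q' 1} ∪
      {n + 1} : Set ℕ) :=
  Nat.sInf_mem ⟨n + 1, Or.inr rfl⟩

theorem one_le_rejLevel (q : ∀ l, Q l) (x : α) : 1 ≤ rejLevel A q x := by
  rcases rejLevel_mem A q x with ⟨l, h, -⟩ | h
  · omega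
  · have : rejLevel A q x = n + 1 := h
    omega

theorem rejLevel_le (q : ∀ l, Q l) (x : α) : rejLevel A q x ≤ n + 1 :=
  Nat.sInf_le (Or.inr rfl)

theorem not_rejecting_of_lt_rejLevel {q : ∀ l, Q l} {x : α} {l : Fin n}
    (h : l.val + 1 < rejLevel A q x) : ¬ ∃ q', (A l).trans (q l) x q' 1 := fun h' =>
  absurd (Nat.sInf_le (Or.inl ⟨l, rfl, h'⟩)) (not_le.2 h)

theorem rejecting_of_rejLevel_eq {q : ∀ l, Q l} {x : α} {l : Fin n}
    (h : rejLevel A q x = l.val + 1) : ∃ q', (A l).trans (q l) x q' 1 := by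
  rcases rejLevel_mem A q x with ⟨l', h', ht⟩ | h'
  · obtain rfl : l = l' := Fin.ext (by omega)
    exact ht
  · have : rejLevel A q x = n + 1 := h'
    have := l.2
    omega

theorem levelOwner_eq_acc_iff {r : ℕ} : levelOwner r = Player.acc ↔ Even r := by
  unfold levelOwner
  split_ifs with h
  · simp [Nat.even_iff, h]
  · simp [Nat.even_iff]; omega

theorem levelOwner_eq_rej_iff {r : ℕ} : levelOwner r = Player.rej ↔ Odd r := by
  unfold levelOwner
  split_ifs with h
  · simp [Nat.odd_iff, h]
  · simp [Nat.odd_iff, h]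

/-- Joint restricted successors can be chosen to dominate given successors on all levels. -/
theorem IsRestriction.exists_dominating (hg : IsRestriction A g) (q : ∀ l, Q l) (x : α)
    (t : ∀ l, Q l) :
    ∃ q' ∈ restrictedSucc g q x, ∀ l, t l ∈ (A l).succ (q l) x →
      jointAcc A l (fun j _ => q' j) (t l) ⊆ jointAcc A l (fun j _ => q' j) (q' l) := by
  -- The restriction on a level depends on the successors chosen below it, so the choice is made for
  -- arbitrary `r` and then tied together by recursion on the level.
  have key : ∀ l (r : ∀ j, j < l → Q j), ∃ s ∈ g l (q l) x r,
      t l ∈ (A l).succ (q l) x → jointAcc A l r (t l) ⊆ jointAcc A l r s := by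
    intro l r
    by_cases h : t l ∈ (A l).succ (q l) x
    · obtain ⟨s, hs, h'⟩ := hg.dominating l (q l) x r (t l) h
      exact ⟨s, hs, fun _ => h'⟩
    · obtain ⟨t', ht'⟩ := (A l).succ_nonempty (q l) x
      obtain ⟨s, hs, -⟩ := hg.dominating l (q l) x r t' ht'
      exact ⟨s, hs, fun h' => absurd h' h⟩
  choose pick hmem hdom using key
  let q' : ∀ l, Q l := (wellFounded_lt (α := Fin n)).fix pick
  have e (l) : q' l = pick l fun j _ => q' j := (wellFounded_lt (α := Fin n)).fix_eq pick l
  refine ⟨q', fun l => ?_, fun l h => ?_⟩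
  · have := hmem l fun j _ => q' j
    rwa [← e l] at this
  · have := hdom l (fun j _ => q' j) h
    rwa [← e l] at this

/-- After the history `L`, `f` moves to restricted successors that dominate the states that the
strategies `F` of the single levels choose after the word read in `L`. -/
def IsDominatingStrategy (A : ∀ l, ParityAutomaton α (Q l))
    (g : ∀ l : Fin n, Q l → α → (∀ j, j < l → Q j) → Set (Q l)) (F : ∀ l, List α → Q l)
    (f : List (reducedStates A g × α) → reducedStates A g) : Prop :=
  ∀ h q x, (f (h ++ [(q, x)])).1 ∈ restrictedSucc g q.1 x ∧
    ∀ l, F l ((h ++ [(q, x)]).map Prod.snd) ∈ (A l).succ (q.1 l) x →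
      jointAcc A l (fun j _ => (f (h ++ [(q, x)])).1 j) (F l ((h ++ [(q, x)]).map Prod.snd)) ⊆
        jointAcc A l (fun j _ => (f (h ++ [(q, x)])).1 j) ((f (h ++ [(q, x)])).1 l)

theorem IsRestriction.exists_isDominatingStrategy (hg : IsRestriction A g)
    (F : ∀ l, List α → Q l) : ∃ f, IsDominatingStrategy A g F f := by
  have key (L : List (reducedStates A g × α)) : ∃ p : reducedStates A g,
      ∀ h q x, L = h ++ [(q, x)] → p.1 ∈ restrictedSucc g q.1 x ∧
        ∀ l, F l (L.map Prod.snd) ∈ (A l).succ (q.1 l) x →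
          jointAcc A l (fun j _ => p.1 j) (F l (L.map Prod.snd)) ⊆
            jointAcc A l (fun j _ => p.1 j) (p.1 l) := by
    rcases L.eq_nil_or_concat' with rfl | ⟨h, ⟨q, x⟩, rfl⟩
    -- No move follows the empty history, so any state serves as default.
    · exact ⟨(reducedProduct A g).init, fun h q x e => by simp at e⟩
    · obtain ⟨q', hq', hd⟩ := hg.exists_dominating q.1 x
        fun l => F l ((h ++ [(q, x)]).map Prod.snd)
      refine ⟨⟨q', Relation.ReflTransGen.tail q.2 ⟨x, hq'⟩⟩, fun h₁ q₁ x₁ e => ?_⟩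
      obtain ⟨rfl, e'⟩ := List.append_inj' e rfl
      obtain ⟨rfl, rfl⟩ : q = q₁ ∧ x = x₁ := by simpa using e'
      exact ⟨hq', by simpa using hd⟩
  choose f hf using key
  exact ⟨f, fun h q x => hf _ h q x rfl⟩

theorem IsRestriction.mem_targets_of_mem_restrictedSucc (hg : IsRestriction A g)
    {q q' : reducedStates A g} {x : α} (h : q'.1 ∈ restrictedSucc g q.1 x) :
    q' ∈ (optimizedProduct A g).targets q x := by
  have hs (l) : q'.1 l ∈ (A l).succ (q.1 l) x := hg.subset _ _ _ _ (h l)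
  exact ⟨fun l _ => hs l, fun l _ => ⟨_, hs l, rfl⟩⟩

theorem IsDominatingStrategy.isStrategy (hg : IsRestriction A g) {F : ∀ l, List α → Q l}
    {f : List (reducedStates A g × α) → reducedStates A g}
    (hf : IsDominatingStrategy A g F f) (P : Player) :
    (optimizedProduct A g).IsStrategy P f := fun h q x _ =>
  hg.mem_targets_of_mem_restrictedSucc (hf h q x).1

/-- Whoever moves, every jump keeps the residual language on each level. -/
theorem isQuasiRun_of_isPlay {w : ℕ → α} {π : ℕ → reducedStates A g}
    (hπ : (optimizedProduct A g).IsPlay w π) (l : Fin n) :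
    (A l).IsQuasiRun w fun i => (π i).1 l := by
  refine ⟨by simp only [hπ.1]; rfl, fun i => ?_⟩
  obtain ⟨h₁, h₂⟩ := hπ.2 i
  rcases lt_or_ge (l.val + 1) (rejLevel A (π i).1 (w i)) with h | h
  · exact ⟨_, h₁ l h, rfl⟩
  · exact h₂ l h

theorem trans_two_of_lt_rejLevel (hA : IsCOCOA A) {w : ℕ → α} {π : ℕ → reducedStates A g}
    (hπ : (optimizedProduct A g).IsPlay w π) {l : Fin n} {i : ℕ}
    (h : l.val + 1 < rejLevel A (π i).1 (w i)) :
    (A l).trans ((π i).1 l) (w i) ((π (i + 1)).1 l) 2 :=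
  (hA.canonical l).coBuchi.trans_two_of_mem_succ ((hπ.2 i).1 l h) (not_rejecting_of_lt_rejLevel h)

/-! ### The natural color -/

theorem bddAbove_levels (A : ∀ l, ParityAutomaton α (Q l)) (w : ℕ → α) :
    BddAbove {k | ∃ l : Fin n, k = l.val + 1 ∧ w ∈ (A l).language} := by
  refine ⟨n, ?_⟩
  rintro k ⟨l, rfl, -⟩
  exact l.2

/-- Since the languages fall, the accepting levels form an initial segment ending at the natural
color. -/
theorem IsCOCOA.mem_language_iff (hA : IsCOCOA A) {w : ℕ → α} {l : Fin n} :
    w ∈ (A l).language ↔ l.val + 1 ≤ naturalColor A w := by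
  constructor
  · exact fun h => le_csSup (bddAbove_levels A w) ⟨l, rfl, h⟩
  · intro h
    have hne : {k | ∃ l : Fin n, k = l.val + 1 ∧ w ∈ (A l).language}.Nonempty := by
      by_contra hne
      rw [Set.not_nonempty_iff_eq_empty] at hne
      rw [naturalColor, hne, csSup_empty] at h
      exact absurd h (by simp)
    obtain ⟨l', e, hl'⟩ := Nat.sSup_mem hne (bddAbove_levels A w)
    have hle : l ≤ l' := by
      have : naturalColor A w = l'.val + 1 := e
      exact Fin.le_def.2 (by omega)
    rcases hle.eq_or_lt with rfl | hlt
    · exact hl'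
    · exact hA.falling l l' hlt hl'

theorem naturalColor_le (A : ∀ l, ParityAutomaton α (Q l)) (w : ℕ → α) : naturalColor A w ≤ n := by
  rcases Set.eq_empty_or_nonempty {k | ∃ l : Fin n, k = l.val + 1 ∧ w ∈ (A l).language} with h | h
  · rw [naturalColor, h, csSup_empty]
    exact Nat.zero_le _
  · refine csSup_le h ?_
    rintro k ⟨l, rfl, -⟩
    exact l.2

/-! ### The least recurring rejecting level of a play -/

/-- A bounded sequence of natural numbers has a least value among those taken infinitely often. -/
theorem exists_least_frequently {c : ℕ → ℕ} {N : ℕ} (hc : ∀ i, c i ≤ N) :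
    ∃ m, (∃ᶠ i in Filter.atTop, c i = m) ∧ ∀ᶠ i in Filter.atTop, m ≤ c i := by
  classical
  have hex : ∃ m, ∃ᶠ i in Filter.atTop, c i = m := by
    by_contra! h
    have h' : ∀ᶠ i in Filter.atTop, ∀ m ∈ Finset.range (N + 1), ¬ c i = m :=
      (Filter.eventually_all_finset _).2 fun m _ => h m
    obtain ⟨i, hi⟩ := h'.exists
    exact hi (c i) (Finset.mem_range.2 (Nat.lt_succ_of_le (hc i))) rfl
  refine ⟨Nat.find hex, Nat.find_spec hex, ?_⟩
  have h' : ∀ᶠ i in Filter.atTop, ∀ m ∈ Finset.range (Nat.find hex), ¬ c i = m :=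
    (Filter.eventually_all_finset _).2 fun m hm =>
      Filter.not_frequently.1 (Nat.find_min hex (Finset.mem_range.1 hm))
  filter_upwards [h'] with i hi
  by_contra hlt
  exact hi (c i) (Finset.mem_range.2 (not_le.1 hlt)) rfl

theorem minEven_iff_even {c : ℕ → ℕ} {m : ℕ} (hf : ∃ᶠ i in Filter.atTop, c i = m)
    (hm : ∀ᶠ i in Filter.atTop, m ≤ c i) : MinEven c ↔ Even m := by
  have hlt : ∀ j < m, ¬ ∃ᶠ i in Filter.atTop, c i = j := fun j hj h => by
    obtain ⟨i, h₁, h₂⟩ := (h.and_eventually hm).exists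
    omega
  refine ⟨?_, fun h => ⟨m, h, hf, hlt⟩⟩
  rintro ⟨k, hk, hkf, hkl⟩
  rcases lt_trichotomy k m with h | rfl | h
  · exact absurd hkf (hlt k h)
  · exact hk
  · exact absurd hf (hkl m h)

/-- In every play the least level that rejects infinitely often is at most one above the natural
color. -/
theorem le_naturalColor_add_one (hA : IsCOCOA A) {w : ℕ → α} {π : ℕ → reducedStates A g}
    (hπ : (optimizedProduct A g).IsPlay w π) {m : ℕ} (hmn : m ≤ n + 1)
    (hm : ∀ᶠ i in Filter.atTop, m ≤ rejLevel A (π i).1 (w i)) :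
    m ≤ naturalColor A w + 1 := by
  by_contra! hlt
  have hn : naturalColor A w < n := by omega
  -- Indices start at 0, so this is the first level rejecting `w`.
  let l : Fin n := ⟨naturalColor A w, hn⟩
  obtain ⟨N, hN⟩ := Filter.eventually_atTop.1 hm
  have hacc : suffix w N ∈ (A l).accLanguage ((π N).1 l) :=
    ParityAutomaton.suffix_mem_accLanguage (ρ := fun i => (π i).1 l)
      (fun i hi => trans_two_of_lt_rejLevel hA hπ (lt_of_lt_of_le hlt (hN i hi))) le_rfl
  have hw : w ∈ (A l).language :=
    ((isQuasiRun_of_isPlay hπ l).suffix_mem_iff (hA.canonical l).nice N).1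
      (ParityAutomaton.accLanguage_subset_languageFrom _ hacc)
  have : naturalColor A w + 1 ≤ naturalColor A w := hA.mem_language_iff.1 hw
  omega

/-- If the player who owns the least level rejecting infinitely often moves by a dominating
strategy, then that level rejects the word. -/
theorem notMem_language_of_isConsistent (hA : IsCOCOA A) {F : ∀ l, List α → Q l}
    (hF : ∀ l w, (A l).IsRunFrom (A l).init w (fun i => F l (pref w i)) ∧
      (w ∈ (A l).language → (A l).IsAcceptingRunFrom (A l).init w (fun i => F l (pref w i))))
    {f : List (reducedStates A g × α) → reducedStates A g}
    (hf : IsDominatingStrategy A g F f) {w : ℕ → α} {π : ℕ → reducedStates A g}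
    (hπ : (optimizedProduct A g).IsPlay w π) {l : Fin n}
    (hc : (optimizedProduct A g).IsConsistent (levelOwner (l.val + 1)) f w π)
    (hfreq : ∃ᶠ i in Filter.atTop, rejLevel A (π i).1 (w i) = l.val + 1)
    (hm : ∀ᶠ i in Filter.atTop, l.val + 1 ≤ rejLevel A (π i).1 (w i)) :
    w ∉ (A l).language := by
  intro hw
  have hcan := hA.canonical l
  obtain ⟨hrun, hacc⟩ := hF l w
  obtain ⟨N, hN⟩ := Filter.eventually_atTop.1
    (hm.and (hcan.coBuchi.eventually_accepting (hacc hw)))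
  obtain ⟨i, hiN, hi⟩ := Filter.frequently_atTop.1 hfreq N
  have hstep : π (i + 1) = f (pref (fun j => (π j, w j)) i ++ [(π i, w i)]) := by
    have := hc i (congrArg levelOwner hi)
    rwa [pref_succ] at this
  have hword : (pref (fun j => (π j, w j)) i ++ [(π i, w i)]).map Prod.snd = pref w (i + 1) := by
    rw [← pref_succ (fun j => (π j, w j)), map_pref]
  -- Play and strategy run have the same residual, and a rejecting state has transitions to all
  -- states equivalent to a successor.
  have hsucc : F l (pref w (i + 1)) ∈ (A l).succ ((π i).1 l) (w i) := by
    obtain ⟨q', hq'⟩ := rejecting_of_rejLevel_eq hi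
    refine ⟨1, hcan.maximal.maximal _ _ ?_ q' ⟨1, hq'⟩ _ ?_⟩
    · rintro ⟨s, hs⟩
      exact hcan.maximal.homogeneous _ _ _ _ ⟨hs, hq'⟩
    · exact hcan.nice.languageFrom_succ_congr
        (hrun.isQuasiRun.languageFrom_eq hcan.nice (isQuasiRun_of_isPlay hπ l) i)
        (hrun.2 i) ⟨1, hq'⟩
  have hdom := (hf (pref (fun j => (π j, w j)) i) (π i) (w i)).2 l
  rw [hword, ← hstep] at hdom
  -- After `N` the lower levels of the play and the run of `F l` only accept, so dominance carries
  -- the tail over to the state of the play.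
  have hstart : suffix w (i + 1) ∈ (A l).accLanguage ((π (i + 1)).1 l) := by
    refine (hdom hsucc ⟨fun j hj => ?_, ?_⟩).2
    · refine ParityAutomaton.suffix_mem_accLanguage (ρ := fun i => (π i).1 j) (N := N)
        (fun k hk => trans_two_of_lt_rejLevel hA hπ ?_) (by omega)
      have h₁ := (hN k hk).1
      have h₂ := Fin.lt_def.1 hj
      omega
    · exact ParityAutomaton.suffix_mem_accLanguage (ρ := fun i => F l (pref w i))
        (fun k hk => (hN k hk).2) (by omega)
  -- An accepting transition on the next letter excludes a rejecting one, by homogeneity.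
  have hlt : ∀ k, i + 1 ≤ k → suffix w k ∈ (A l).accLanguage ((π k).1 l) →
      l.val + 1 < rejLevel A (π k).1 (w k) := by
    intro k hk h
    refine lt_of_le_of_ne (hN k (by omega)).1 fun e => ?_
    obtain ⟨q', hq'⟩ := rejecting_of_rejLevel_eq e.symm
    obtain ⟨s, hs, -⟩ := ParityAutomaton.exists_trans_of_suffix_mem_accLanguage h
    exact hcan.maximal.homogeneous _ _ _ _ ⟨hs, hq'⟩
  have hstay : ∀ k, i + 1 ≤ k → suffix w k ∈ (A l).accLanguage ((π k).1 l) := by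
    intro k hk
    induction k, hk using Nat.le_induction with
    | base => exact hstart
    | succ k hk ih =>
      obtain ⟨s, hs, hs'⟩ := ParityAutomaton.exists_trans_of_suffix_mem_accLanguage ih
      have := hcan.nice.acc_det _ _ _ _ (trans_two_of_lt_rejLevel hA hπ (hlt k hk ih)) hs
      rwa [this]
  obtain ⟨k, hk, hk'⟩ := Filter.frequently_atTop.1 hfreq (i + 1)
  have := hlt k hk (hstay k hk)
  omega

/-- The winner of a play is given by the parity of the least level rejecting infinitely often,
which a player moving by a dominating strategy owns only if it is above the natural color. -/
theorem exists_level_of_isConsistent (hA : IsCOCOA A) {F : ∀ l, List α → Q l}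
    (hF : ∀ l w, (A l).IsRunFrom (A l).init w (fun i => F l (pref w i)) ∧
      (w ∈ (A l).language → (A l).IsAcceptingRunFrom (A l).init w (fun i => F l (pref w i))))
    {f : List (reducedStates A g × α) → reducedStates A g}
    (hf : IsDominatingStrategy A g F f) {P : Player} {w : ℕ → α} {π : ℕ → reducedStates A g}
    (hπ : (optimizedProduct A g).IsPlay w π) (hc : (optimizedProduct A g).IsConsistent P f w π) :
    ∃ m, ((optimizedProduct A g).AcceptorWinsPlay w π ↔ Odd m) ∧
      (m = naturalColor A w + 1 ∨ levelOwner m ≠ P) := by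
  obtain ⟨m, hfreq, hm⟩ :=
    exists_least_frequently (c := fun i => rejLevel A (π i).1 (w i)) fun i => rejLevel_le _ _
  obtain ⟨i, hi⟩ := hfreq.exists
  have hm1 : 1 ≤ m := hi ▸ one_le_rejLevel (A := A) (π i).1 (w i)
  have hmn : m ≤ n + 1 := hi ▸ rejLevel_le (A := A) (π i).1 (w i)
  have hle := le_naturalColor_add_one hA hπ hmn hm
  refine ⟨m, ?_, ?_⟩
  · have hwin : (optimizedProduct A g).AcceptorWinsPlay w π ↔ Even (m - 1) :=
      minEven_iff_even (c := fun i => rejLevel A (π i).1 (w i) - 1)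
        (hfreq.mono fun i h => by rw [h]) (hm.mono fun i h => Nat.sub_le_sub_right h 1)
    rw [hwin, Nat.even_iff, Nat.odd_iff]
    omega
  · rw [or_iff_not_imp_left]
    rintro hne rfl
    have hk := naturalColor_le A w
    -- The value `m = n + 1` is impossible here: with `hle` and `hk` it would make `m` the natural
    -- color plus one.
    obtain ⟨l, rfl⟩ : ∃ l : Fin n, m = l.val + 1 := ⟨⟨m - 1, by omega⟩, by simp; omega⟩
    exact notMem_language_of_isConsistent hA hF hf hπ hc hfreq hm
      (hA.mem_language_iff.2 (by omega))

/-! ### From prefix strategies to acceptance of a single word -/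

namespace SimpleAlternating

variable {S : Type*} {B : SimpleAlternating α S}

/-- A strategy for the fixed word `w` may know `w`, so it can restore the letters by zipping the
state history with a prefix of `w`. -/
theorem accepts_of_isStrategy {f : List (S × α) → S} (hf : B.IsStrategy Player.acc f) {w : ℕ → α}
    (h : ∀ π, B.IsPlay w π → B.IsConsistent Player.acc f w π → B.AcceptorWinsPlay w π) :
    B.Accepts w := by
  let pair (L : List S) : List (S × α) := L.zip (pref w L.length)
  have hpair (h : List S) (q : S) : pair (h ++ [q]) = pair h ++ [(q, w h.length)] := by
    simp only [pair, List.length_append, List.length_singleton, pref_succ]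
    rw [List.zip_append (length_pref w h.length).symm]
    rfl
  have hpref (π : ℕ → S) (i : ℕ) : pair (pref π i) = pref (fun j => (π j, w j)) i := by
    induction i with
    | zero => rfl
    | succ i ih => rw [pref_succ, hpair, ih, length_pref, pref_succ]
  refine ⟨fun L => f (pair L), fun h q hq => ?_, fun π hπ hc => h π hπ fun i hi => ?_⟩
  · simp only [hpair]
    exact hf _ _ _ hq
  · rw [← hpref]
    exact hc i hi

/-- Only one winner is possible when an alleged winning strategy of the acceptor is played against
`f`. -/
theorem not_accepts_of_isStrategy {f : List (S × α) → S} (hf : B.IsStrategy Player.rej f)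
    {w : ℕ → α}
    (h : ∀ π, B.IsPlay w π → B.IsConsistent Player.rej f w π → ¬ B.AcceptorWinsPlay w π) :
    ¬ B.Accepts w := by
  classical
  rintro ⟨e, he, hwin⟩
  -- a stage of the play of the two strategies against each other: the history and the current state
  let move (H : List (S × α)) (q : S) : S :=
    if B.owner q (w H.length) = Player.acc then e (H.map Prod.fst ++ [q])
    else f (H ++ [(q, w H.length)])
  let stage : ℕ → List (S × α) × S := fun i =>
    Nat.rec ([], B.init) (fun _ p => (p.1 ++ [(p.2, w p.1.length)], move p.1 p.2)) i
  let π : ℕ → S := fun i => (stage i).2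
  have hstage (i : ℕ) : (stage i).1 = pref (fun j => (π j, w j)) i := by
    induction i with
    | zero => rfl
    | succ i ih =>
      have hs : (stage (i + 1)).1 = (stage i).1 ++ [(π i, w (stage i).1.length)] := rfl
      rw [hs, ih, length_pref, pref_succ]
  have hmove (i : ℕ) : π (i + 1) = if B.owner (π i) (w i) = Player.acc then e (pref π (i + 1))
      else f (pref (fun j => (π j, w j)) (i + 1)) := by
    have hs : π (i + 1) = move (stage i).1 (π i) := rfl
    rw [hs, hstage]
    simp only [move, length_pref, map_pref, pref_succ]
  have hacc (i : ℕ) (hi : B.owner (π i) (w i) = Player.acc) : π (i + 1) = e (pref π (i + 1)) := by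
    rw [hmove, if_pos hi]
  have hrej (i : ℕ) (hi : B.owner (π i) (w i) = Player.rej) :
      π (i + 1) = f (pref (fun j => (π j, w j)) (i + 1)) := by
    rw [hmove, if_neg (by simp [hi])]
  have hplay : B.IsPlay w π := by
    refine ⟨rfl, fun i => ?_⟩
    rcases hi : B.owner (π i) (w i) with _ | _
    · rw [hrej i hi, pref_succ]
      exact hf _ _ _ hi
    · rw [hacc i hi, pref_succ]
      have := he (pref π i) (π i)
      rw [length_pref] at this
      exact this hi
  exact h π hplay hrej (hwin π hplay hacc)

end SimpleAlternating

end Cocoa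

theorem mainTheorem2 {α : Type*} [Finite α] {n : ℕ} {Q : Fin n → Type*} [∀ l, Finite (Q l)]
    (A : ∀ l, Cocoa.ParityAutomaton α (Q l)) (hA : Cocoa.IsCOCOA A)
    (g : ∀ l : Fin n, Q l → α → (∀ j, j < l → Q j) → Set (Q l))
    (hg : Cocoa.IsRestriction A g) :
    (Cocoa.optimizedProduct A g).IsGFG ∧
      (Cocoa.optimizedProduct A g).language = Cocoa.chainLanguage A := by
  choose F hF using fun l => (hA.canonical l).gfg
  obtain ⟨f, hf⟩ := hg.exists_isDominatingStrategy F
  have hacc (w : ℕ → α) (hw : Even (Cocoa.naturalColor A w)) (π)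
      (hπ : (Cocoa.optimizedProduct A g).IsPlay w π)
      (hc : (Cocoa.optimizedProduct A g).IsConsistent Cocoa.Player.acc f w π) :
      (Cocoa.optimizedProduct A g).AcceptorWinsPlay w π := by
    obtain ⟨m, hm, rfl | h⟩ := Cocoa.exists_level_of_isConsistent hA hF hf hπ hc
    · exact hm.2 hw.add_one
    -- The rejector owns the recurring level, so it is odd and the acceptor wins.
    · rw [Ne, Cocoa.levelOwner_eq_acc_iff, Nat.not_even_iff_odd] at h
      exact hm.2 h
  have hrej (w : ℕ → α) (hw : ¬ Even (Cocoa.naturalColor A w)) (π)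
      (hπ : (Cocoa.optimizedProduct A g).IsPlay w π)
      (hc : (Cocoa.optimizedProduct A g).IsConsistent Cocoa.Player.rej f w π) :
      ¬ (Cocoa.optimizedProduct A g).AcceptorWinsPlay w π := by
    obtain ⟨m, hm, rfl | h⟩ := Cocoa.exists_level_of_isConsistent hA hF hf hπ hc
    · rwa [hm, Nat.odd_add_one, not_not, ← Nat.not_even_iff_odd]
    · rw [Ne, Cocoa.levelOwner_eq_rej_iff] at h
      rwa [hm]
  -- This turns acceptance in the good-for-games condition into parity of the natural color.
  have hlang : (Cocoa.optimizedProduct A g).language = Cocoa.chainLanguage A := by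
    ext w
    refine ⟨fun h => ?_, fun h => ?_⟩
    · by_contra hw
      exact Cocoa.SimpleAlternating.not_accepts_of_isStrategy (hf.isStrategy hg _) (hrej w hw) h
    · exact Cocoa.SimpleAlternating.accepts_of_isStrategy (hf.isStrategy hg _) (hacc w h)
  refine ⟨⟨⟨f, hf.isStrategy hg _, fun w hw => hacc w ?_⟩,
    f, hf.isStrategy hg _, fun w hw => hrej w ?_⟩, hlang⟩
  · exact hlang.subset hw
  · exact fun h => hw (hlang.superset h)
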